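/- Let $\Phi_{\rm m},\Phi_{\rm s}$ (macro and small-cell base stations) be independent homogeneous Poisson point processes in $\mathbb R^2$ with densities $\lambda_{\rm m},\lambda_{\rm s}>0$. Independently of them, let $\Phi_{\rm bl}$ be a random collection of blockages: line segments of common length $L_{\rm bl}\ge 0$ whose midpoints form a homogeneous Poisson point process of density $\lambda_{\rm bl}\ge 0$ and whose orientations are i.i.d. uniform on $(0,2\pi]$, independent of the midpoints. The link between ${\bf x}$ and ${\bf y}$ has state $s({\bf x},{\bf y})=\ell$ if the segment $\overline{{\bf x},{\bf y}}$ meets no blockage, and $s({\bf x},{\bf y})={\rm n}$ otherwise. For $k\in\{{\rm a},{\rm b}\}$ (access, backhaul) and $i\in\{{\rm m},{\rm s}\}$ the pathloss of a link of type $k$ from a tier-$i$ base station at ${\bf x}$ to a receiver at ${\bf y}$ is $L_{k_i}({\bf x},{\bf y})=\|{\bf x}-{\bf y}\|^{\alpha_{k_{i,s({\bf x},{\bf y})}}}$, with exponents $\alpha_{k_{i,\ell}},\alpha_{k_{i,{\rm n}}}>0$ and the convention $1/0=\infty$. Let $P_i,T_i,\beta_{{\rm a}_i},G_i,G_{\rm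 u}>0$ be constants (transmit powers, biases, reference losses, antenna gains). A user at the origin is served by the base station ${\bf x}^*$ maximizing $P_iT_i\beta_{{\rm a}_i}G_iG_{\rm u}L_{{\rm a}_i}({\bf x},{\bf 0})^{-1}$ over ${\bf x}\in\Phi_i$, $i\in\{{\rm m},{\rm s}\}$; put ${\cal A}_i=\mathbb P({\bf x}^*\in\Phi_i)$. The access association cell of ${\bf x}\in\Phi_i$ is $${\cal C}_{{\rm a}_i}({\bf x})=\{{\bf z}\in\mathbb R^2: P_iT_i\beta_{{\rm a}_i}G_iL_{{\rm a}_i}({\bf x},{\bf z})^{-1}\ge P_jT_j\beta_{{\rm a}_j}G_jL_{{\rm a}_j}({\bf y},{\bf z})^{-1}\ \ \forall\,{\bf y}\in\Phi_j,\ j\in\{{\rm m},{\rm s}\}\},$$ and the backhaul association cell of ${\bf x}\in\Phi_{\rm m}$ is $${\cal C}_{\rm b}({\bf x})=\{{\bf z}\in\mathbb R^2: L_{{\rm b}_{\rm m}}({\bf x},{\bf z})^{-1}\ge L_{{\rm b}_{\rm m}}({\bf y},{\bf z})^{-1}\ \ \forall\,{\bf y}\in\Phi_{\rm m}\}.$$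 For a nonnegative functional $f$ of the network let $\mathbb E^{0}_i[f]=\frac1{\lambda_i|W|}\,\mathbb E\sum_{{\bf x}\in\Phi_i\cap W}f(\text{network translated by }-{\bf x})$ be its expectation as seen from a typical point of $\Phi_i$ (Palm expectation), where $W\subseteq\mathbb R^2$ is a Borel set with $0<|W|<\infty$ and $|\cdot|$ is the Lebesgue measure. Then, for every such $W$, the mean area of a typical backhaul association cell is $\mathbb E^{0}_{\rm m}[|{\cal C}_{\rm b}({\bf 0})|]=\frac1{\lambda_{\rm m}}$, and the mean area of a typical access association cell of tier $i$ is $\mathbb E^{0}_i[|{\cal C}_{{\rm a}_i}({\bf 0})|]=\frac{{\cal A}_i}{\lambda_i}$ for $i\in\{{\rm m},{\rm s}\}$. -/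

import Mathlib

open MeasureTheory ProbabilityTheory
open scoped ENNReal NNReal

namespace IAB

noncomputable section

/-! ### Point processes, given by random locally finite sets of points -/

/-- A (simple) point process on `S`: a random set of points, finite on bounded sets, whose
counting variables `Φ(B)`, for measurable `B`, are measurable. -/
structure IsPointProcess {Ω : Type*} [MeasurableSpace Ω] {S : Type*} [MeasurableSpace S]
    [Bornology S] (Φ : Ω → Set S) : Prop where
  finite_inter : ∀ ω (B : Set S), Bornology.IsBounded B → (Φ ω ∩ B).Finite
  measurable_count : ∀ B : Set S, MeasurableSet B → Measurable fun ω => (Φ ω ∩ B).encard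

/-- A Poisson point process with intensity measure `Λ`: the number of points in `B` has the Poisson
law with mean `Λ B`, and the numbers of points in pairwise disjoint sets are independent. -/
structure IsPoissonProcess {Ω : Type*} [MeasurableSpace Ω] {S : Type*} [MeasurableSpace S]
    [Bornology S] (Φ : Ω → Set S) (Λ : Measure S) (μ : Measure Ω) : Prop
    extends IsPointProcess Φ where
  count_law : ∀ B : Set S, MeasurableSet B → Λ B ≠ ∞ → ∀ n : ℕ,
    μ {ω | (Φ ω ∩ B).encard = n} = poissonMeasure (Λ B).toNNReal {n}
  indep_counts : ∀ (k : ℕ) (B : Fin k → Set S), (∀ i, MeasurableSet (B i)) →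
    Pairwise (fun i j => Disjoint (B i) (B j)) →
    iIndepFun (fun i ω => (Φ ω ∩ B i).encard) μ

/-- The σ-algebra on `Ω` generated by a point process, that is, by its counting variables. -/
@[reducible] def sigmaOf {Ω S : Type*} [MeasurableSpace S] (Φ : Ω → Set S) : MeasurableSpace Ω :=
  ⨆ (B : Set S) (_ : MeasurableSet B),
    MeasurableSpace.comap (fun ω => (Φ ω ∩ B).encard) inferInstance

/-! ### The network -/

/-- The plane `ℝ²` with the Euclidean norm; its `volume` is the Lebesgue measure. -/
abbrev Plane : Type := EuclideanSpace ℝ (Fin 2)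

/-- The two tiers of base stations: macro (`m`) and small cell (`s`). -/
inductive Tier
  | m
  | s

/-- The two types of links. -/
inductive LinkType
  | access
  | backhaul

/-- Line-of-sight or non-line-of-sight. -/
inductive LinkState
  | los
  | nlos

/-- The deterministic constants of the network: transmit powers `P i`, association biases `T i`,
access propagation losses at the reference distance `β i`, main-lobe antenna gains `G i` of the base
stations and `Gu` of the users, pathloss exponents `α k i s`, and the common length `Lbl` of the
blockages. -/
structure Params where
  P : Tier → ℝ
  T : Tier → ℝ
  β : Tier → ℝ
  G : Tier → ℝ
  Gu : ℝ
  α : LinkType → Tier → LinkState → ℝ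
  Lbl : ℝ
  P_pos : ∀ i, 0 < P i
  T_pos : ∀ i, 0 < T i
  β_pos : ∀ i, 0 < β i
  G_pos : ∀ i, 0 < G i
  Gu_pos : 0 < Gu
  α_pos : ∀ k i s, 0 < α k i s
  Lbl_nonneg : 0 ≤ Lbl

/-- A realization of the network: the base stations of each tier, and the blockages, each encoded by
its midpoint and its orientation angle. -/
structure Config where
  bs : Tier → Set Plane
  bl : Set (Plane × ℝ)

/-- The realization seen from `x`: everything is translated by `-x`. -/
def Config.seenFrom (c : Config) (x : Plane) : Config where
  bs i := {y | y + x ∈ c.bs i}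
  bl := {q | (q.1 + x, q.2) ∈ c.bl}

/-- The line segment of length `len`, midpoint `q.1` and orientation `q.2`. -/
def blockageSegment (len : ℝ) (q : Plane × ℝ) : Set Plane :=
  segment ℝ (q.1 - (len / 2) • !₂[Real.cos q.2, Real.sin q.2])
    (q.1 + (len / 2) • !₂[Real.cos q.2, Real.sin q.2])

open Classical in
/-- The state of the link between `x` and `y`: line-of-sight if and only if no blockage meets the
line segment between `x` and `y`. -/
def linkState (p : Params) (c : Config) (x y : Plane) : LinkState :=
  if ∀ q ∈ c.bl, Disjoint (blockageSegment p.Lbl q) (segment ℝ x y) then .los else .nlos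

/-- The pathloss `L_{k,i}(‖x - y‖)` of the link of type `k` between a base station of tier `i` at
`x` and a receiver at `y`, as an extended nonnegative number (so that `L⁻¹ = ∞` if `x = y`). -/
def pathloss (p : Params) (c : Config) (k : LinkType) (i : Tier) (x y : Plane) : ℝ≥0∞ :=
  ENNReal.ofReal (‖x - y‖ ^ p.α k i (linkState p c x y))

/-! ### Association -/

/-- The biased average power received at `y` from a base station of tier `i` at `x`. -/
def biasedPower (p : Params) (c : Config) (i : Tier) (x y : Plane) : ℝ≥0∞ :=
  ENNReal.ofReal (p.P i * p.T i * p.β i * p.G i * p.Gu) * (pathloss p c .access i x y)⁻¹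

/-- `x` is a base station of tier `i` that maximizes, over the base stations of both tiers, the
biased average power received at the origin (where the typical user is). -/
def ServesOrigin (p : Params) (c : Config) (i : Tier) (x : Plane) : Prop :=
  x ∈ c.bs i ∧ ∀ j, ∀ y ∈ c.bs j, biasedPower p c j y 0 ≤ biasedPower p c i x 0

/-- The association probability of tier `i`: the probability that the base station serving the
typical user belongs to tier `i`. -/
def assocProb {Ω : Type*} [MeasurableSpace Ω] (μ : Measure Ω) (p : Params) (net : Ω → Config)
    (i : Tier) : ℝ≥0∞ :=
  μ {ω | ∃ x, ServesOrigin p (net ω) i x}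

/-- The access association cell of a base station of tier `i` at `x`. -/
def accessCell (p : Params) (c : Config) (i : Tier) (x : Plane) : Set Plane :=
  {z | ∀ j, ∀ y ∈ c.bs j,
    ENNReal.ofReal (p.P j * p.T j * p.β j * p.G j) * (pathloss p c .access j y z)⁻¹ ≤
      ENNReal.ofReal (p.P i * p.T i * p.β i * p.G i) * (pathloss p c .access i x z)⁻¹}

/-- The backhaul association cell of a macro base station at `x`. -/
def backhaulCell (p : Params) (c : Config) (x : Plane) : Set Plane :=
  {z | ∀ y ∈ c.bs .m, (pathloss p c .backhaul .m y z)⁻¹ ≤ (pathloss p c .backhaul .m x z)⁻¹}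

/-! ### The random network and its typical points -/

/-- The base stations of tier `i` form a homogeneous Poisson process of density `lam i`; the
blockages have midpoints forming a homogeneous Poisson process of density `lamBl` that is
independently marked with uniform orientations in `(0, 2π]` (that is, midpoints and orientations
together form a Poisson process whose intensity is the product of `lamBl` times the Lebesgue measure
and the uniform law); and the three processes are independent. -/
structure IsNetwork {Ω : Type*} [MeasurableSpace Ω] (μ : Measure Ω) (net : Ω → Config)
    (lam : Tier → ℝ) (lamBl : ℝ) : Prop where
  poisson_bs : ∀ i, IsPoissonProcess (fun ω => (net ω).bs i)
    (ENNReal.ofReal (lam i) • (volume : Measure Plane)) μ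
  poisson_bl : IsPoissonProcess (fun ω => (net ω).bl)
    ((ENNReal.ofReal lamBl • (volume : Measure Plane)).prod
      (volume[|Set.Ioc (0 : ℝ) (2 * Real.pi)])) μ
  indep : iIndep ![sigmaOf fun ω => (net ω).bs .m, sigmaOf fun ω => (net ω).bs .s,
    sigmaOf fun ω => (net ω).bl] μ

/-- The Palm expectation of `f` with respect to the tier-`i` base stations (of density `lam`),
computed with the window `W`:
`(lam |W|)⁻¹ 𝔼 ∑_{x ∈ Φ_i ∩ W} f (network seen from x)`.
It is the mean of `f` for the network as seen from a typical tier-`i` base station, which is located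
at the origin. -/
def palmMean {Ω : Type*} [MeasurableSpace Ω] (μ : Measure Ω) (net : Ω → Config) (i : Tier)
    (lam : ℝ) (W : Set Plane) (f : Config → ℝ≥0∞) : ℝ≥0∞ :=
  (ENNReal.ofReal lam * volume W)⁻¹ *
    ∫⁻ ω, ∑' x : ↥((net ω).bs i ∩ W), f ((net ω).seenFrom x) ∂μ

end

end IAB

namespace IAB

noncomputable section

/-! ### Counting kernels of point processes -/

section PointProcess

/-! Fix a tier and say that a station at `x` is related to `z` when `z` lies in the cell of `x`. By
Tonelli, the mean total area of the cells of the stations in `W` is the integral over `z` of the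
expected number of stations in `W` related to `z`. Stationarity recentres `z` at the origin and
replaces `W` by a translate; integrating over `z` then gives `|W|` times the expected number of
stations related to the origin (`lintegral_volume_cells`). Almost surely this number is 0 or 1, so
its mean is the probability that such a station exists, and dividing by the density times `|W|`
gives the mean cell area (`IsNetwork.palmMean_volume_cell`). For access cells this probability is
the association probability. For backhaul cells it is one: almost surely there is a macro station,
and local finiteness lets some station attain the least pathloss.

Stationarity (`IsNetwork.measurePreserving_shift`) holds because void probabilities determine the
law and depend only on translation-invariant intensities. Uniqueness (`IsNetwork.ae_unique_serving`)
holds because, for given link states, a tie confines one station to a circle determined by the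
other, and pairs of distinct Poisson points avoid such null relations
(`IsPoissonProcess.ae_notMem_of_ne`). Only ties within one tier matter, since the association event
asks only for a server in that tier. -/

theorem countable_of_finite_inter {S : Type*} [MetricSpace S] {F : Set S}
    (h : ∀ B : Set S, Bornology.IsBounded B → (F ∩ B).Finite) : F.Countable := by
  rcases isEmpty_or_nonempty S with hS | ⟨⟨o⟩⟩
  · exact Set.countable_univ.mono (Set.subset_univ _)
  · have : F = ⋃ n : ℕ, F ∩ Metric.ball o n := by
      rw [← Set.inter_iUnion, Metric.iUnion_ball_nat, Set.inter_univ]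
    rw [this]
    exact Set.countable_iUnion fun n => (h _ Metric.isBounded_ball).countable

/-- Removing the finitely many other points from the unit ball about `x` leaves an open
neighbourhood. Taking `D` in a countable basis keeps later unions over `D` measurable. -/
theorem exists_basis_inter_eq_singleton {S : Type*} [MetricSpace S]
    [SecondCountableTopology S] {F : Set S}
    (h : ∀ B : Set S, Bornology.IsBounded B → (F ∩ B).Finite) {x : S} (hx : x ∈ F) :
    ∃ D ∈ TopologicalSpace.countableBasis S, F ∩ D = {x} := by
  have hfin := h _ (Metric.isBounded_ball (x := x) (r := 1))
  have ho : IsOpen (Metric.ball x 1 \ ((F ∩ Metric.ball x 1) \ {x})) :=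
    Metric.isOpen_ball.sdiff (hfin.subset Set.sdiff_subset).isClosed
  obtain ⟨D, hD, hxD, hDs⟩ := (TopologicalSpace.isBasis_countableBasis S).exists_subset_of_mem_open
    (a := x) (by simp) ho
  refine ⟨D, hD, Set.Subset.antisymm (fun y hy => ?_) (by simpa using ⟨hx, hxD⟩)⟩
  by_contra hyx
  exact (hDs hy.2).2 ⟨⟨hy.1, (hDs hy.2).1⟩, hyx⟩

theorem IsPointProcess.countable {X S : Type*} [MeasurableSpace X] [MetricSpace S]
    [MeasurableSpace S] {Φ : X → Set S} (h : IsPointProcess Φ) (x : X) : (Φ x).Countable :=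
  countable_of_finite_inter (h.finite_inter x)

variable {X S : Type*} [MeasurableSpace X] [MetricSpace S] [SecondCountableTopology S]
  [MeasurableSpace S] [BorelSpace S] {Φ : X → Set S}

/-- A family of locally finite sets whose void events are measurable is a point process. -/
theorem IsPointProcess.of_measurableSet_void
    (hfin : ∀ x (B : Set S), Bornology.IsBounded B → (Φ x ∩ B).Finite)
    (hvoid : ∀ B : Set S, MeasurableSet B → Bornology.IsBounded B →
      MeasurableSet {x | Φ x ∩ B = ∅}) : IsPointProcess Φ := by
  refine ⟨hfin, ?_⟩
  have hvoid' : ∀ B : Set S, MeasurableSet B → MeasurableSet {x | Φ x ∩ B = ∅} := by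
    intro B hB
    rcases isEmpty_or_nonempty S with hS | ⟨⟨o⟩⟩
    · simp [Set.eq_empty_of_isEmpty]
    · have : {x | Φ x ∩ B = ∅} = ⋂ n : ℕ, {x | Φ x ∩ (B ∩ Metric.ball o n) = ∅} := by
        ext x
        simp only [Set.mem_ofPred_eq, Set.mem_iInter]
        rw [← Set.iUnion_eq_empty, ← Set.inter_iUnion, ← Set.inter_iUnion, Metric.iUnion_ball_nat,
          Set.inter_univ]
      rw [this]
      exact MeasurableSet.iInter fun n => hvoid _ (hB.inter measurableSet_ball)
        (Metric.isBounded_ball.subset Set.inter_subset_right)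
  have hge : ∀ k : ℕ, ∀ B : Set S, MeasurableSet B →
      MeasurableSet {x | (k : ℕ∞) ≤ (Φ x ∩ B).encard} := by
    intro k
    induction k with
    | zero => simp
    | succ k ih =>
      intro B hB
      -- Some basic set `D` isolates one point, leaving at least `k` points in `B \ D`; conversely,
      -- a nonvoid `B ∩ D` adds at least one. Void events thus control all counts by induction on
      -- `k`.
      have : {x | ((k + 1 : ℕ) : ℕ∞) ≤ (Φ x ∩ B).encard} =
          ⋃ D ∈ TopologicalSpace.countableBasis S, {x | Φ x ∩ (B ∩ D) = ∅}ᶜ ∩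
            {x | (k : ℕ∞) ≤ (Φ x ∩ (B \ D)).encard} := by
        ext x
        simp only [Set.mem_ofPred_eq, Set.mem_iUnion, Set.mem_inter_iff, Set.mem_compl_iff,
          exists_prop]
        have hsplit : ∀ D : Set S, (Φ x ∩ B).encard =
            (Φ x ∩ (B ∩ D)).encard + (Φ x ∩ (B \ D)).encard := by
          intro D
          rw [← Set.encard_union_eq, ← Set.inter_union_distrib_left, Set.inter_union_sdiff]
          exact (Set.disjoint_sdiff_right.mono_left Set.inter_subset_right).mono
            Set.inter_subset_right Set.inter_subset_right
        constructor
        · intro hk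
          have hne : (Φ x ∩ B).Nonempty := by
            rw [← Set.encard_pos]
            exact lt_of_lt_of_le (by simp) hk
          obtain ⟨y, hy, hyB⟩ := hne
          obtain ⟨D, hD, hDy⟩ := exists_basis_inter_eq_singleton (hfin x) hy
          have h1 : Φ x ∩ (B ∩ D) = {y} := by
            rw [Set.inter_comm B, ← Set.inter_assoc, hDy]
            simpa using hyB
          refine ⟨D, hD, by simp [h1], ?_⟩
          rw [hsplit D, h1, Set.encard_singleton, Nat.cast_add, Nat.cast_one,
            add_comm (k : ℕ∞)] at hk
          exact (ENat.add_le_add_iff_left (ENat.natCast_ne_top 1)).1 hk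
        · rintro ⟨D, hD, h1, h2⟩
          rw [hsplit D, Nat.cast_add, Nat.cast_one, add_comm (k : ℕ∞)]
          refine add_le_add ?_ h2
          rw [Set.one_le_encard_iff_nonempty]
          exact Set.nonempty_iff_ne_empty.2 h1
      rw [this]
      refine MeasurableSet.biUnion (TopologicalSpace.countable_countableBasis S) fun D hD => ?_
      have hDm := (TopologicalSpace.isOpen_of_mem_countableBasis hD).measurableSet
      exact (hvoid' _ (hB.inter hDm)).compl.inter (ih _ (hB.diff hDm))
  intro B hB
  refine measurable_to_countable' fun n => ?_
  induction n using ENat.recTopCoe with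
  | top =>
    have : (fun x => (Φ x ∩ B).encard) ⁻¹' {⊤} = ⋂ k : ℕ, {x | (k : ℕ∞) ≤ (Φ x ∩ B).encard} := by
      ext x
      simp only [Set.mem_preimage, Set.mem_singleton_iff, Set.mem_iInter, Set.mem_ofPred_eq]
      exact ⟨fun h => by simp [h], fun h => ENat.eq_top_iff_forall_ge.2 h⟩
    rw [this]
    exact MeasurableSet.iInter fun k => hge k B hB
  | coe n =>
    have : (fun x => (Φ x ∩ B).encard) ⁻¹' {(n : ℕ∞)} =
        {x | (n : ℕ∞) ≤ (Φ x ∩ B).encard} \ {x | ((n + 1 : ℕ) : ℕ∞) ≤ (Φ x ∩ B).encard} := by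
      ext x
      simp only [Set.mem_preimage, Set.mem_singleton_iff, Set.mem_sdiff, Set.mem_ofPred_eq, not_le,
        Nat.cast_add, Nat.cast_one]
      rw [ENat.lt_add_one_iff (by simp)]
      exact ⟨fun h => ⟨h.ge, h.le⟩, fun h => le_antisymm h.2 h.1⟩
    rw [this]
    exact (hge _ B hB).diff (hge _ B hB)

theorem count_restrict_apply {F B : Set S} (hF : F.Countable) (hB : MeasurableSet B) :
    (Measure.count.restrict F : Measure S) B = ((F ∩ B).encard : ℝ≥0∞) := by
  rw [Measure.restrict_apply hB, Set.inter_comm, Measure.count_apply (hF.measurableSet.inter hB)]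

/-- The random counting measure of a point process. -/
def pointKernel (h : IsPointProcess Φ) : Kernel X S where
  toFun x := Measure.count.restrict (Φ x)
  measurable' := by
    refine Measure.measurable_of_measurable_coe _ fun B hB => ?_
    simp_rw [count_restrict_apply (countable_of_finite_inter (h.finite_inter _)) hB]
    exact Measurable.of_discrete.comp (h.measurable_count B hB)

theorem pointKernel_apply (h : IsPointProcess Φ) (x : X) :
    pointKernel h x = Measure.count.restrict (Φ x) := rfl

theorem pointKernel_apply' (h : IsPointProcess Φ) (x : X) {B : Set S} (hB : MeasurableSet B) :
    pointKernel h x B = ((Φ x ∩ B).encard : ℝ≥0∞) :=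
  count_restrict_apply (h.countable x) hB

theorem lintegral_pointKernel (h : IsPointProcess Φ) (x : X) (f : S → ℝ≥0∞) :
    ∫⁻ y, f y ∂pointKernel h x = ∑' y : Φ x, f y := by
  rw [pointKernel_apply, lintegral_countable _ (h.countable x)]
  simp

theorem setLIntegral_pointKernel (h : IsPointProcess Φ) (x : X) (f : S → ℝ≥0∞) {W : Set S}
    (hW : MeasurableSet W) :
    ∫⁻ y in W, f y ∂pointKernel h x = ∑' y : ↥(Φ x ∩ W), f y := by
  rw [pointKernel_apply, Measure.restrict_restrict hW, Set.inter_comm,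
    lintegral_countable _ ((h.countable x).mono Set.inter_subset_left)]
  simp

/-- Needed for Tonelli with kernels. Counts in a bounded set are finite but not uniformly so; the
space is cut into bounded shells and `X` according to the count `k` in each shell, so that each
piece has mass at most `k`. -/
instance pointKernel_isSFiniteKernel (h : IsPointProcess Φ) : IsSFiniteKernel (pointKernel h) := by
  classical
  rcases isEmpty_or_nonempty S with hS | ⟨⟨o⟩⟩
  · have : pointKernel h = 0 := by
      ext x s
      simp [Set.eq_empty_of_isEmpty s]
    rw [this]
    infer_instance
  let A : ℕ → Set S := disjointed fun n : ℕ => Metric.ball o n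
  have hA : ∀ n, MeasurableSet (A n) := fun n =>
    MeasurableSet.disjointed (fun n => measurableSet_ball) n
  have hAb : ∀ n, Bornology.IsBounded (A n) := fun n =>
    Metric.isBounded_ball.subset (disjointed_subset _ n)
  have hAU : ⋃ n, A n = Set.univ := by
    rw [iUnion_disjointed, Metric.iUnion_ball_nat]
  let E : ℕ × ℕ → Set X := fun i => {x | (Φ x ∩ A i.1).encard = i.2}
  have hE : ∀ i, MeasurableSet (E i) := fun i =>
    h.measurable_count _ (hA i.1) (measurableSet_singleton (i.2 : ℕ∞))
  let κ : ℕ × ℕ → Kernel X S := fun i =>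
    Kernel.piecewise (hE i) ((pointKernel h).restrict (hA i.1)) 0
  have hκ : ∀ i, IsFiniteKernel (κ i) := by
    intro i
    refine ⟨⟨i.2, by simp, fun x => ?_⟩⟩
    rw [Kernel.piecewise_apply']
    split_ifs with hx
    · rw [Kernel.restrict_apply, Measure.restrict_apply_univ, pointKernel_apply' h x (hA i.1)]
      have hx' : (Φ x ∩ A i.1).encard = i.2 := hx
      simp [hx']
    · simp
  have hsum : pointKernel h = Kernel.sum κ := by
    ext x s hs
    rw [Kernel.sum_apply' _ _ hs, ENNReal.tsum_prod']
    -- Only the term whose `k` is the actual count in `A n` is nonzero.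
    have : ∀ n, ∑' k, κ (n, k) x s = pointKernel h x (s ∩ A n) := by
      intro n
      have hf := h.finite_inter x (A n) (hAb n)
      have hc : ((hf.toFinset.card : ℕ) : ℕ∞) = (Φ x ∩ A n).encard := by
        rw [hf.encard_eq_coe_toFinset_card]
      have hmem : x ∈ E (n, hf.toFinset.card) := hc.symm
      have hpos : ∀ i, x ∈ E i → κ i x s = pointKernel h x (s ∩ A i.1) := fun i hi => by
        rw [Kernel.piecewise_apply', if_pos hi, Kernel.restrict_apply, Measure.restrict_apply hs]
      rw [tsum_eq_single hf.toFinset.card]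
      · exact hpos _ hmem
      · intro k hk
        have hk' : x ∉ E (n, k) := fun hk' => by
          have hk'' : (Φ x ∩ A n).encard = k := hk'
          rw [← hc] at hk''
          exact hk (by exact_mod_cast hk''.symm)
        rw [Kernel.piecewise_apply', if_neg hk']
        simp
    simp_rw [this]
    rw [← measure_iUnion (fun i j hij => ((disjoint_disjointed _ hij).mono
      Set.inter_subset_right Set.inter_subset_right)) (fun n => hs.inter (hA n)),
      ← Set.inter_iUnion, hAU, Set.inter_univ]
  rw [hsum]
  infer_instance

/-- Quantifying over the points of a point process preserves measurability. -/
theorem measurableSet_exists_mem_point (h : IsPointProcess Φ) {Y : Type*} [MeasurableSpace Y]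
    {g : Y → X} (hg : Measurable g) {R : Set (Y × S)} (hR : MeasurableSet R) :
    MeasurableSet {y | ∃ x ∈ Φ (g y), (y, x) ∈ R} := by
  have hm := Kernel.measurable_kernel_prodMk_left (κ := (pointKernel h).comap g hg) hR
  -- Existence means that the section of `R` has nonzero counting mass, which is measurable in `y`.
  have : {y | ∃ x ∈ Φ (g y), (y, x) ∈ R} =
      (fun y => (pointKernel h).comap g hg y (Prod.mk y ⁻¹' R)) ⁻¹' {0}ᶜ := by
    ext y
    simp only [Set.mem_preimage, Set.mem_compl_iff, Set.mem_singleton_iff, Kernel.comap_apply]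
    rw [pointKernel_apply' h _ (measurable_prodMk_left hR)]
    simp only [ENat.toENNReal_eq_zero, Set.encard_eq_zero, Set.mem_ofPred_eq]
    rw [← ne_eq, ← Set.nonempty_iff_ne_empty]
    rfl
  rw [this]
  exact hm (measurableSet_singleton 0).compl

end PointProcess

/-! ### The space of locally finite configurations and the law of the network -/

/-- Bounded regions contain finitely many base stations and blockages. -/
structure Config.LocallyFinite (c : Config) : Prop where
  bs_finite : ∀ i (B : Set Plane), Bornology.IsBounded B → (c.bs i ∩ B).Finite
  bl_finite : ∀ B : Set (Plane × ℝ), Bornology.IsBounded B → (c.bl ∩ B).Finite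

/-- The space of locally finite configurations. -/
abbrev LFConfig : Type := {c : Config // c.LocallyFinite}

/-- The configurations with no base station of tier `i` in `A i` and no blockage in `C`. -/
def voidEvent (A : Tier → Set Plane) (C : Set (Plane × ℝ)) : Set LFConfig :=
  {c | (∀ i, c.1.bs i ∩ A i = ∅) ∧ c.1.bl ∩ C = ∅}

/-- The void events of bounded measurable regions. -/
def voidEvents : Set (Set LFConfig) :=
  {E | ∃ A C, ((∀ i, MeasurableSet (A i)) ∧ MeasurableSet C) ∧
    ((∀ i, Bornology.IsBounded (A i)) ∧ Bornology.IsBounded C) ∧ E = voidEvent A C}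

/-- Void events suffice to make all counts measurable, and they form a shift-stable π-system with
explicit probabilities. -/
instance : MeasurableSpace LFConfig := MeasurableSpace.generateFrom voidEvents

theorem isPiSystem_voidEvents : IsPiSystem voidEvents := by
  rintro _ ⟨A, C, hm, hb, rfl⟩ _ ⟨A', C', hm', hb', rfl⟩ -
  refine ⟨fun i => A i ∪ A' i, C ∪ C', ⟨fun i => (hm.1 i).union (hm'.1 i), hm.2.union hm'.2⟩,
    ⟨fun i => (hb.1 i).union (hb'.1 i), hb.2.union hb'.2⟩, ?_⟩
  ext c
  simp only [voidEvent, Set.mem_inter_iff, Set.mem_ofPred_eq, Set.inter_union_distrib_left,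
    Set.union_empty_iff, forall_and]
  tauto

open Classical in
theorem isPointProcess_bs (i : Tier) : IsPointProcess fun c : LFConfig => c.1.bs i := by
  refine .of_measurableSet_void (fun c => c.2.bs_finite i) fun B hB hBb =>
    MeasurableSpace.measurableSet_generateFrom
      ⟨fun j => if j = i then B else ∅, ∅, ⟨fun j => ?_, .empty⟩,
        ⟨fun j => ?_, Bornology.isBounded_empty⟩, ?_⟩
  · dsimp only
    split_ifs
    exacts [hB, .empty]
  · dsimp only
    split_ifs
    exacts [hBb, Bornology.isBounded_empty]
  · ext c
    simp only [voidEvent, Set.mem_ofPred_eq, Set.inter_empty, and_true]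
    refine ⟨fun h j => ?_, fun h => by simpa using h i⟩
    split_ifs with hj
    · rw [hj, h]
    · simp

theorem isPointProcess_bl : IsPointProcess fun c : LFConfig => c.1.bl := by
  refine .of_measurableSet_void (fun c => c.2.bl_finite) fun B hB hBb =>
    MeasurableSpace.measurableSet_generateFrom
      ⟨fun _ => ∅, B, ⟨fun _ => .empty, hB⟩, ⟨fun _ => Bornology.isBounded_empty, hBb⟩, ?_⟩
  ext c
  simp [voidEvent]

/-! ### Translations of configurations -/

theorem preimage_inter_eq_preimage_image {S : Type*} (e : S ≃ S) (F B : Set S) :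
    e ⁻¹' F ∩ B = e ⁻¹' (F ∩ e '' B) := by
  rw [Set.preimage_inter, Set.preimage_image_eq _ e.injective]

/-- Translation of marked points by `x`. -/
def translateMarked (x : Plane) : Plane × ℝ ≃ᵐ Plane × ℝ :=
  (MeasurableEquiv.addRight x).prodCongr (MeasurableEquiv.refl ℝ)

theorem translateMarked_apply (x : Plane) (q : Plane × ℝ) :
    translateMarked x q = (q.1 + x, q.2) := rfl

theorem isBounded_image_addRight (x : Plane) {B : Set Plane} (hB : Bornology.IsBounded B) :
    Bornology.IsBounded (MeasurableEquiv.addRight x '' B) :=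
  (LipschitzWith.id.add (LipschitzWith.const x)).isBounded_image hB

theorem isBounded_image_translateMarked (x : Plane) {B : Set (Plane × ℝ)}
    (hB : Bornology.IsBounded B) : Bornology.IsBounded (translateMarked x '' B) :=
  ((LipschitzWith.prod_fst.add (LipschitzWith.const x)).prodMk
    LipschitzWith.prod_snd).isBounded_image hB

theorem Config.seenFrom_bs (c : Config) (x : Plane) (i : Tier) :
    (c.seenFrom x).bs i = MeasurableEquiv.addRight x ⁻¹' c.bs i := rfl

theorem Config.seenFrom_bl (c : Config) (x : Plane) :
    (c.seenFrom x).bl = translateMarked x ⁻¹' c.bl := rfl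

theorem Config.LocallyFinite.seenFrom {c : Config} (hc : c.LocallyFinite) (x : Plane) :
    (c.seenFrom x).LocallyFinite := by
  constructor
  · intro i B hB
    rw [c.seenFrom_bs, ← MeasurableEquiv.coe_toEquiv, preimage_inter_eq_preimage_image]
    exact (hc.bs_finite i _ (isBounded_image_addRight x hB)).preimage (Equiv.injective _).injOn
  · intro B hB
    rw [c.seenFrom_bl, ← MeasurableEquiv.coe_toEquiv, preimage_inter_eq_preimage_image]
    exact (hc.bl_finite _ (isBounded_image_translateMarked x hB)).preimage
      (Equiv.injective _).injOn

/-- The locally finite configuration seen from `x`. -/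
def LFConfig.shift (x : Plane) (c : LFConfig) : LFConfig := ⟨c.1.seenFrom x, c.2.seenFrom x⟩

theorem preimage_shift_voidEvent (x : Plane) (A : Tier → Set Plane) (C : Set (Plane × ℝ)) :
    LFConfig.shift x ⁻¹' voidEvent A C =
      voidEvent (fun i => MeasurableEquiv.addRight x '' A i) (translateMarked x '' C) := by
  ext c
  have h {S : Type} (e : S ≃ S) (F B : Set S) : e ⁻¹' F ∩ B = ∅ ↔ F ∩ e '' B = ∅ := by
    rw [preimage_inter_eq_preimage_image, Set.preimage_eq_empty_iff, e.range_eq_univ,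
      Set.disjoint_univ]
  exact and_congr (forall_congr' fun i => h (MeasurableEquiv.addRight x).toEquiv _ _)
    (h (translateMarked x).toEquiv _ _)

theorem preimage_shift_mem_voidEvents (x : Plane) {E : Set LFConfig} (hE : E ∈ voidEvents) :
    LFConfig.shift x ⁻¹' E ∈ voidEvents := by
  obtain ⟨A, C, hm, hb, rfl⟩ := hE
  exact ⟨_, _, ⟨fun i => (MeasurableEquiv.measurableSet_image _).2 (hm.1 i),
    (MeasurableEquiv.measurableSet_image _).2 hm.2⟩,
    ⟨fun i => isBounded_image_addRight x (hb.1 i), isBounded_image_translateMarked x hb.2⟩,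
    preimage_shift_voidEvent x A C⟩

theorem measurable_shift (x : Plane) : Measurable (LFConfig.shift x) :=
  measurable_generateFrom fun _ hE =>
    MeasurableSpace.measurableSet_generateFrom (preimage_shift_mem_voidEvents x hE)

theorem measurableSet_void_sigmaOf {Ω S : Type*} [MeasurableSpace S] {Φ : Ω → Set S} {B : Set S}
    (hB : MeasurableSet B) : MeasurableSet[sigmaOf Φ] {ω | Φ ω ∩ B = ∅} := by
  have hle : MeasurableSpace.comap (fun ω => (Φ ω ∩ B).encard) inferInstance ≤ sigmaOf Φ :=
    le_iSup₂_of_le B hB le_rfl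
  refine hle _ ⟨{0}, measurableSet_singleton 0, ?_⟩
  ext ω
  simp

section Law

variable {Ω : Type*} [MeasurableSpace Ω] {μ : Measure Ω}

theorem IsPointProcess.sigmaOf_le {S : Type*} [MeasurableSpace S] [Bornology S] {Φ : Ω → Set S}
    (h : IsPointProcess Φ) : sigmaOf Φ ≤ ‹MeasurableSpace Ω› :=
  iSup₂_le fun B hB => (h.measurable_count B hB).comap_le

theorem IsPoissonProcess.measure_void {S : Type*} [MeasurableSpace S] [Bornology S]
    {Φ : Ω → Set S} {Λ : Measure S} (h : IsPoissonProcess Φ Λ μ) {B : Set S}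
    (hB : MeasurableSet B) (hΛ : Λ B ≠ ∞) :
    μ {ω | Φ ω ∩ B = ∅} = poissonMeasure (Λ B).toNNReal {0} := by
  simpa using h.count_law B hB hΛ 0

variable {net : Ω → Config} {lam : Tier → ℝ} {lamBl : ℝ}

/-- The intensity measure of the blockages. -/
def blockageIntensity (lamBl : ℝ) : Measure (Plane × ℝ) :=
  (ENNReal.ofReal lamBl • (volume : Measure Plane)).prod
    (volume[|Set.Ioc (0 : ℝ) (2 * Real.pi)])

theorem blockageIntensity_image_translateMarked (x : Plane) (C : Set (Plane × ℝ)) :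
    blockageIntensity lamBl (translateMarked x '' C) = blockageIntensity lamBl C := by
  have h1 : MeasurePreserving (fun y : Plane => y + x) (ENNReal.ofReal lamBl • volume)
      (ENNReal.ofReal lamBl • volume) := by
    refine ⟨measurable_add_const x, ?_⟩
    rw [Measure.map_smul, map_add_right_eq_self]
  have h2 : MeasurePreserving (translateMarked x) (blockageIntensity lamBl)
      (blockageIntensity lamBl) :=
    h1.prod (MeasurePreserving.id _)
  rw [← h2.measure_preimage_equiv, Set.preimage_image_eq _ (translateMarked x).injective]

theorem blockageIntensity_ne_top {C : Set (Plane × ℝ)} (hC : Bornology.IsBounded C) :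
    blockageIntensity lamBl C ≠ ∞ := by
  have hsub : C ⊆ (Prod.fst '' C) ×ˢ Set.univ := fun q hq => ⟨⟨q, hq, rfl⟩, trivial⟩
  refine ne_top_of_le_ne_top ?_ (measure_mono hsub)
  rw [blockageIntensity, Measure.prod_prod]
  refine ENNReal.mul_ne_top (ENNReal.mul_ne_top ENNReal.ofReal_ne_top ?_) (measure_ne_top _ _)
  exact (LipschitzWith.prod_fst.isBounded_image hC).measure_lt_top.ne

theorem IsNetwork.locallyFinite (h : IsNetwork μ net lam lamBl) (ω : Ω) :
    (net ω).LocallyFinite :=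
  ⟨fun i => (h.poisson_bs i).finite_inter ω, h.poisson_bl.finite_inter ω⟩

/-- The network as a map into the space of locally finite configurations. -/
def IsNetwork.toLFConfig (h : IsNetwork μ net lam lamBl) (ω : Ω) : LFConfig :=
  ⟨net ω, h.locallyFinite ω⟩

/-- The intersection is indexed by `Fin 3` to match the independent family of σ-algebras in
`IsNetwork.indep`. -/
theorem IsNetwork.preimage_voidEvent (h : IsNetwork μ net lam lamBl) (A : Tier → Set Plane)
    (C : Set (Plane × ℝ)) :
    h.toLFConfig ⁻¹' voidEvent A C = ⋂ k : Fin 3, ![{ω | (net ω).bs .m ∩ A .m = ∅},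
      {ω | (net ω).bs .s ∩ A .s = ∅}, {ω | (net ω).bl ∩ C = ∅}] k := by
  ext ω
  simp only [Set.mem_preimage, voidEvent, Set.mem_ofPred_eq, Set.mem_iInter, Fin.forall_fin_succ,
    IsEmpty.forall_iff, and_true]
  constructor
  · rintro ⟨h1, h2⟩
    exact ⟨h1 .m, h1 .s, h2⟩
  · rintro ⟨h1, h2, h3⟩
    exact ⟨fun i => by cases i; exacts [h1, h2], h3⟩

theorem IsNetwork.measurable_toLFConfig (h : IsNetwork μ net lam lamBl) :
    Measurable h.toLFConfig := by
  refine measurable_generateFrom ?_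
  rintro _ ⟨A, C, hm, -, rfl⟩
  rw [h.preimage_voidEvent]
  refine MeasurableSet.iInter fun k => ?_
  fin_cases k
  · exact (h.poisson_bs .m).sigmaOf_le _ (measurableSet_void_sigmaOf (hm.1 .m))
  · exact (h.poisson_bs .s).sigmaOf_le _ (measurableSet_void_sigmaOf (hm.1 .s))
  · exact h.poisson_bl.sigmaOf_le _ (measurableSet_void_sigmaOf hm.2)

theorem IsNetwork.measure_voidEvent (h : IsNetwork μ net lam lamBl) {A : Tier → Set Plane}
    {C : Set (Plane × ℝ)} (hm : (∀ i, MeasurableSet (A i)) ∧ MeasurableSet C)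
    (hb : (∀ i, Bornology.IsBounded (A i)) ∧ Bornology.IsBounded C) :
    μ (h.toLFConfig ⁻¹' voidEvent A C) =
      poissonMeasure (ENNReal.ofReal (lam .m) * volume (A .m)).toNNReal {0} *
      poissonMeasure (ENNReal.ofReal (lam .s) * volume (A .s)).toNNReal {0} *
      poissonMeasure (blockageIntensity lamBl C).toNNReal {0} := by
  have hfin : ∀ i, (ENNReal.ofReal (lam i) • (volume : Measure Plane)) (A i) ≠ ∞ := fun i =>
    ENNReal.mul_ne_top ENNReal.ofReal_ne_top (hb.1 i).measure_lt_top.ne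
  rw [h.preimage_voidEvent, h.indep.meas_iInter, Fin.prod_univ_three]
  · exact congrArg₂ _ (congrArg₂ _ ((h.poisson_bs .m).measure_void (hm.1 .m) (hfin .m))
      ((h.poisson_bs .s).measure_void (hm.1 .s) (hfin .s)))
      (h.poisson_bl.measure_void hm.2 (blockageIntensity_ne_top hb.2))
  · intro k
    fin_cases k
    · exact measurableSet_void_sigmaOf (hm.1 .m)
    · exact measurableSet_void_sigmaOf (hm.1 .s)
    · exact measurableSet_void_sigmaOf hm.2

/-- The law of the network on the space of locally finite configurations. -/
def IsNetwork.law (h : IsNetwork μ net lam lamBl) : Measure LFConfig := μ.map h.toLFConfig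

instance IsNetwork.isProbabilityMeasure_law [IsProbabilityMeasure μ]
    (h : IsNetwork μ net lam lamBl) : IsProbabilityMeasure h.law :=
  Measure.isProbabilityMeasure_map h.measurable_toLFConfig.aemeasurable

/-- The network is stationary. -/
theorem IsNetwork.measurePreserving_shift [IsProbabilityMeasure μ]
    (h : IsNetwork μ net lam lamBl) (x : Plane) :
    MeasurePreserving (LFConfig.shift x) h.law h.law := by
  refine ⟨measurable_shift x, ?_⟩
  have : IsProbabilityMeasure (h.law.map (LFConfig.shift x)) :=
    Measure.isProbabilityMeasure_map (measurable_shift x).aemeasurable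
  -- Two probability measures agreeing on a generating π-system coincide; here void probabilities
  -- see only intensities, which translation preserves.
  refine ext_of_generate_finite voidEvents rfl isPiSystem_voidEvents ?_ (by simp)
  intro E hE
  rw [Measure.map_apply (measurable_shift x) (MeasurableSpace.measurableSet_generateFrom hE),
    IsNetwork.law, Measure.map_apply h.measurable_toLFConfig
      (MeasurableSpace.measurableSet_generateFrom (preimage_shift_mem_voidEvents x hE)),
    Measure.map_apply h.measurable_toLFConfig (MeasurableSpace.measurableSet_generateFrom hE)]
  obtain ⟨A, C, hm, hb, rfl⟩ := hE
  have hA : ∀ i, volume (MeasurableEquiv.addRight x '' A i) = volume (A i) := fun i => by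
    rw [MeasurableEquiv.coe_addRight, Set.image_add_right, measure_preimage_add_right]
  rw [preimage_shift_voidEvent, h.measure_voidEvent hm hb, h.measure_voidEvent
    ⟨fun i => (MeasurableEquiv.measurableSet_image _).2 (hm.1 i),
      (MeasurableEquiv.measurableSet_image _).2 hm.2⟩
    ⟨fun i => isBounded_image_addRight x (hb.1 i), isBounded_image_translateMarked x hb.2⟩,
    hA, hA, blockageIntensity_image_translateMarked]

end Law

/-! ### The mass transport principle -/

/-- The counting kernel of the base stations of tier `i`. -/
def bsKernel (i : Tier) : Kernel LFConfig Plane := pointKernel (isPointProcess_bs i)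

instance (i : Tier) : IsSFiniteKernel (bsKernel i) :=
  inferInstanceAs (IsSFiniteKernel (pointKernel _))

theorem lintegral_bsKernel_shift (i : Tier) (c : LFConfig) (z : Plane) (f : Plane → ℝ≥0∞) :
    ∫⁻ y, f (y + z) ∂bsKernel i (c.shift z) = ∫⁻ x, f x ∂bsKernel i c := by
  rw [bsKernel, lintegral_pointKernel, lintegral_pointKernel]
  exact Equiv.tsum_eq ((Equiv.addRight z).subtypeEquiv
    (p := (· ∈ (c.shift z).1.bs i)) (q := (· ∈ c.1.bs i)) fun y => Iff.rfl) fun x => f x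

theorem measurableSet_exists_related (i : Tier) {R : Set ((LFConfig × Plane) × Plane)}
    (hR : MeasurableSet R) {z : LFConfig → Plane} (hz : Measurable z) :
    MeasurableSet {c : LFConfig | ∃ x ∈ c.1.bs i, ((c, z c), x) ∈ R} := by
  have hg : Measurable fun r : LFConfig × Plane => ((r.1, z r.1), r.2) := by fun_prop
  exact measurableSet_exists_mem_point (isPointProcess_bs i) measurable_id (hR.preimage hg)

/-- Measurability of the event of non-uniqueness lets an almost sure statement on `Ω` be transferred
to the law on `LFConfig`. -/
theorem measurableSet_exists_ne_related (i : Tier) {R : Set ((LFConfig × Plane) × Plane)}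
    (hR : MeasurableSet R) {z : LFConfig → Plane} (hz : Measurable z) :
    MeasurableSet {c : LFConfig | ∃ x ∈ c.1.bs i, ((c, z c), x) ∈ R ∧
      ∃ y ∈ c.1.bs i, ((c, z c), y) ∈ R ∧ x ≠ y} := by
  have hg : Measurable fun r : LFConfig × Plane => ((r.1, z r.1), r.2) := by fun_prop
  have hg' : Measurable fun r : (LFConfig × Plane) × Plane => ((r.1.1, z r.1.1), r.2) := by
    fun_prop
  have hne : MeasurableSet {r : (LFConfig × Plane) × Plane | r.1.2 ≠ r.2} :=
    (measurableSet_eq_fun (by fun_prop) (by fun_prop)).compl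
  have h := measurableSet_exists_mem_point (isPointProcess_bs i) measurable_fst
    ((hR.preimage hg').inter hne)
  exact measurableSet_exists_mem_point (isPointProcess_bs i) measurable_id
    ((hR.preimage hg).inter h)

/-- Let every location `z` be related to at most one base station of tier `i`, in a stationary way.
Then the mean total area of the sets of locations related to the base stations in `W` is the area of
`W` times the probability that the origin is related to a base station. -/
theorem lintegral_volume_cells {Q : Measure LFConfig} [SFinite Q]
    (hQ : ∀ x, MeasurePreserving (LFConfig.shift x) Q Q) (i : Tier)
    {R : Set ((LFConfig × Plane) × Plane)} (hR : MeasurableSet R)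
    (hcov : ∀ c x z t, ((LFConfig.shift t c, z), x) ∈ R ↔ ((c, z + t), x + t) ∈ R)
    (huniq : ∀ᵐ c ∂Q, ∀ x ∈ c.1.bs i, ∀ y ∈ c.1.bs i,
      ((c, 0), x) ∈ R → ((c, 0), y) ∈ R → x = y)
    {W : Set Plane} (hW : MeasurableSet W) :
    ∫⁻ c, ∫⁻ x in W, volume {z | ((c, z), x) ∈ R} ∂bsKernel i c ∂Q =
      volume W * Q {c | ∃ x ∈ c.1.bs i, ((c, 0), x) ∈ R} := by
  set r : (LFConfig × Plane) × Plane → ℝ≥0∞ := R.indicator 1 with hr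
  set w : Plane → ℝ≥0∞ := W.indicator 1 with hw
  have hrm : Measurable r := measurable_one.indicator hR
  have hwm : Measurable w := measurable_one.indicator hW
  have hRx : ∀ c x, MeasurableSet {z | ((c, z), x) ∈ R} := fun c x =>
    hR.preimage (measurable_prodMk_right.comp measurable_prodMk_left)
  have hR0 : ∀ c, MeasurableSet {x | ((c, 0), x) ∈ R} := fun c => measurable_prodMk_left hR
  -- `H z` is the integrand `F · z` after recentring at `z`: the relation is tested at the origin
  -- and the window is translated instead.
  let H : Plane → LFConfig → ℝ≥0∞ := fun z c => ∫⁻ x, w (x + z) * r ((c, 0), x) ∂bsKernel i c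
  have hHm : Measurable (Function.uncurry H) := by
    have : Measurable fun p : (Plane × LFConfig) × Plane =>
        w (p.2 + p.1.1) * r ((p.1.2, 0), p.2) := by fun_prop
    exact this.lintegral_kernel_prod_right' (κ := (bsKernel i).comap Prod.snd measurable_snd)
  let F : LFConfig → Plane → ℝ≥0∞ := fun c z => ∫⁻ x, w x * r ((c, z), x) ∂bsKernel i c
  have hFm : Measurable (Function.uncurry F) := by
    have : Measurable fun p : (LFConfig × Plane) × Plane => w p.2 * r p := by fun_prop
    exact this.lintegral_kernel_prod_right' (κ := (bsKernel i).comap Prod.fst measurable_fst)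
  have h1 : ∀ c, ∫⁻ x in W, volume {z | ((c, z), x) ∈ R} ∂bsKernel i c = ∫⁻ z, F c z := by
    intro c
    rw [lintegral_lintegral_swap (by fun_prop), ← lintegral_indicator hW]
    refine lintegral_congr fun x => ?_
    rw [lintegral_const_mul _ (by fun_prop)]
    have : ∫⁻ z, r ((c, z), x) = volume {z | ((c, z), x) ∈ R} := by
      rw [← lintegral_indicator_one (hRx c x)]
      rfl
    rw [this]
    by_cases hx : x ∈ W <;> simp [hw, hx]
  have h2 : ∀ c z, F c z = H z (c.shift z) := by
    intro c z
    simp only [F, H]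
    rw [← lintegral_bsKernel_shift i c z]
    refine lintegral_congr fun y => ?_
    congr 1
    have := hcov c y 0 z
    rw [zero_add] at this
    by_cases hy : ((c, z), y + z) ∈ R
    · rw [hr, Set.indicator_of_mem hy, Set.indicator_of_mem (this.2 hy)]
      rfl
    · rw [hr, Set.indicator_of_notMem hy, Set.indicator_of_notMem (mt this.1 hy)]
  -- For fixed `x` only `w (x + z)` depends on `z`, and its integral is `volume W` by translation
  -- invariance.
  have h3 : ∀ c, ∫⁻ z, H z c = volume W * bsKernel i c {x | ((c, 0), x) ∈ R} := by
    intro c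
    simp only [H]
    rw [lintegral_lintegral_swap (by fun_prop), ← lintegral_indicator_one (hR0 c),
      ← lintegral_const_mul _ (measurable_one.indicator (hR0 c))]
    refine lintegral_congr fun x => ?_
    rw [lintegral_mul_const _ (by fun_prop), lintegral_add_left_eq_self w x, hw,
      lintegral_indicator_one hW]
    rfl
  have hex : MeasurableSet {c : LFConfig | ∃ x ∈ c.1.bs i, ((c, 0), x) ∈ R} :=
    measurableSet_exists_related i hR measurable_const
  calc ∫⁻ c, ∫⁻ x in W, volume {z | ((c, z), x) ∈ R} ∂bsKernel i c ∂Q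
      = ∫⁻ z, ∫⁻ c, F c z ∂Q := by
        simp_rw [h1]
        exact lintegral_lintegral_swap hFm.aemeasurable
    _ = ∫⁻ z, ∫⁻ c, H z c ∂Q := by
        refine lintegral_congr fun z => ?_
        simp_rw [h2]
        exact (hQ z).lintegral_comp (hHm.comp measurable_prodMk_left)
    _ = ∫⁻ c, volume W * bsKernel i c {x | ((c, 0), x) ∈ R} ∂Q := by
        rw [lintegral_lintegral_swap hHm.aemeasurable]
        simp_rw [h3]
    _ = volume W * Q {c | ∃ x ∈ c.1.bs i, ((c, 0), x) ∈ R} := by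
        rw [← lintegral_indicator_one hex, ← lintegral_const_mul _ (measurable_one.indicator hex)]
        refine lintegral_congr_ae ?_
        -- By uniqueness the number of related stations is the indicator of existence.
        filter_upwards [huniq] with c hc
        congr 1
        rw [bsKernel, pointKernel_apply' _ _ (hR0 c)]
        by_cases h : ∃ x ∈ c.1.bs i, ((c, 0), x) ∈ R
        · obtain ⟨x, hx, hxR⟩ := h
          have : c.1.bs i ∩ {x | ((c, 0), x) ∈ R} = {x} :=
            Set.eq_singleton_iff_unique_mem.2
              ⟨⟨hx, hxR⟩, fun y hy => hc y hy.1 x hx hy.2 hxR⟩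
          rw [this, Set.indicator_of_mem (Set.mem_ofPred_eq ▸ ⟨x, hx, hxR⟩)]
          simp
        · have : c.1.bs i ∩ {x | ((c, 0), x) ∈ R} = ∅ :=
            Set.eq_empty_iff_forall_notMem.2 fun x hx => h ⟨x, hx.1, hx.2⟩
          rw [this, Set.indicator_of_notMem (Set.mem_ofPred_eq ▸ h)]
          simp

/-! ### Pairs of points of a Poisson process -/

/-- Only finiteness of the mean is needed: `n ≤ 2 ^ n` reduces it to the exponential series at `2 *
r`. -/
theorem tsum_poissonMeasure_mul_ne_top (r : ℝ≥0) :
    ∑' n : ℕ, (n : ℝ≥0∞) * poissonMeasure r {n} ≠ ∞ := by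
  have hs : Summable fun n : ℕ => (n : ℝ) * (Real.exp (-r) * r ^ n / (n.factorial : ℝ)) := by
    refine .of_nonneg_of_le (fun n => by positivity) (fun n => ?_)
      ((Real.summable_pow_div_factorial (2 * r)).mul_left (Real.exp (-r)))
    have h2 : (n : ℝ) ≤ 2 ^ n := by exact_mod_cast Nat.lt_two_pow_self.le
    calc (n : ℝ) * (Real.exp (-r) * r ^ n / (n.factorial : ℝ))
        ≤ 2 ^ n * (Real.exp (-r) * r ^ n / (n.factorial : ℝ)) := by gcongr
      _ = Real.exp (-r) * ((2 * r) ^ n / (n.factorial : ℝ)) := by rw [mul_pow]; ring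
  convert hs.tsum_ofReal_ne_top using 4 with n
  rw [poissonMeasure_singleton, ENNReal.ofReal_mul (by positivity), ENNReal.ofReal_natCast]

theorem IsPoissonProcess.ae_inter_eq_empty {X S : Type*} [MeasurableSpace X]
    [Bornology S] [MeasurableSpace S] {Φ : X → Set S} {Λ : Measure S} {μ : Measure X}
    [IsProbabilityMeasure μ]
    (h : IsPoissonProcess Φ Λ μ) {B : Set S} (hB : MeasurableSet B) (hΛ : Λ B = 0) :
    ∀ᵐ ω ∂μ, Φ ω ∩ B = ∅ := by
  have hm : MeasurableSet {ω | Φ ω ∩ B = ∅} :=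
    h.sigmaOf_le _ (measurableSet_void_sigmaOf hB)
  refine (mem_ae_iff_prob_eq_one hm).2 ?_
  rw [h.measure_void hB (by simp [hΛ]), hΛ, poissonMeasure_singleton]
  simp

section PointProcess

variable {X S : Type*} [MeasurableSpace X] [MetricSpace S] [SecondCountableTopology S]
  [MeasurableSpace S] [BorelSpace S] {Φ : X → Set S} {Λ : Measure S} {μ : Measure X}

/-- A Poisson process is a point process. -/
theorem IsPoissonProcess.counts {X S : Type*} [MeasurableSpace X] [Bornology S]
    [MeasurableSpace S] {Φ : X → Set S} {Λ : Measure S} {μ : Measure X}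
    (h : IsPoissonProcess Φ Λ μ) : IsPointProcess Φ :=
  ⟨h.finite_inter, h.measurable_count⟩

/-- The expected number of points of a Poisson process in a bounded set is finite. -/
theorem IsPoissonProcess.bind_pointKernel_ne_top (h : IsPoissonProcess Φ Λ μ) {B : Set S}
    (hB : MeasurableSet B) (hBb : Bornology.IsBounded B) (hΛ : Λ B ≠ ∞) :
    μ.bind (pointKernel h.counts) B ≠ ∞ := by
  rw [Measure.bind_apply hB (Kernel.aemeasurable _)]
  have hm : Measurable fun ω => (Φ ω ∩ B).encard.toNat :=
    Measurable.of_discrete.comp (h.measurable_count B hB)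
  have hcast : ∀ ω, (((Φ ω ∩ B).encard.toNat : ℕ) : ℕ∞) = (Φ ω ∩ B).encard := fun ω =>
    ENat.natCast_toNat (h.finite_inter ω B hBb).encard_lt_top.ne
  have heq : ∀ ω, pointKernel h.counts ω B =
      (((Φ ω ∩ B).encard.toNat : ℕ) : ℝ≥0∞) := fun ω => by
    rw [pointKernel_apply' _ _ hB, ← hcast ω]
    simp
  simp_rw [heq]
  rw [← lintegral_map (f := fun n : ℕ => (n : ℝ≥0∞)) .of_discrete hm, lintegral_countable']
  convert tsum_poissonMeasure_mul_ne_top (Λ B).toNNReal using 4 with n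
  rw [← h.count_law B hB hΛ n, Measure.map_apply hm (measurableSet_singleton n)]
  congr 1
  ext ω
  simp only [Set.mem_preimage, Set.mem_singleton_iff, Set.mem_ofPred_eq]
  rw [← hcast ω]
  norm_cast

/-- σ-finiteness of the mean counting measure is what allows a product measure to be identified by
its values on rectangles. -/
theorem IsPoissonProcess.sigmaFinite_bind_pointKernel (h : IsPoissonProcess Φ Λ μ)
    (hΛ : ∀ B, Bornology.IsBounded B → Λ B ≠ ∞) :
    SigmaFinite (μ.bind (pointKernel h.counts)) := by
  rcases isEmpty_or_nonempty S with hS | ⟨⟨o⟩⟩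
  · have : μ.bind (pointKernel h.counts) = 0 := by
      ext s
      simp [Set.eq_empty_of_isEmpty s]
    rw [this]
    infer_instance
  · exact ⟨⟨⟨fun n : ℕ => Metric.ball o n, fun _ => trivial, fun n =>
      (h.bind_pointKernel_ne_top measurableSet_ball Metric.isBounded_ball
        (hΛ _ Metric.isBounded_ball)).lt_top, Metric.iUnion_ball_nat o⟩⟩⟩

theorem IsPoissonProcess.bind_pointKernel_eq_zero [IsProbabilityMeasure μ]
    (h : IsPoissonProcess Φ Λ μ) {B : Set S} (hB : MeasurableSet B) (hΛ : Λ B = 0) :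
    μ.bind (pointKernel h.counts) B = 0 := by
  rw [Measure.bind_apply hB (Kernel.aemeasurable _), lintegral_eq_zero_iff
    (Kernel.measurable_coe _ hB)]
  filter_upwards [h.ae_inter_eq_empty hB hΛ] with ω hω
  rw [pointKernel_apply' _ _ hB, hω]
  simp

/-- The pairs of points of a Poisson process in two disjoint sets avoid a null set of pairs. -/
theorem IsPoissonProcess.ae_notMem_of_disjoint [IsProbabilityMeasure μ]
    (h : IsPoissonProcess Φ Λ μ) (hΛ : ∀ B, Bornology.IsBounded B → Λ B ≠ ∞)
    {A B : Set S} (hA : MeasurableSet A) (hB : MeasurableSet B) (hAB : Disjoint A B)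
    {N : Set (S × S)} (hN : MeasurableSet N) (hN0 : ∀ x, Λ (Prod.mk x ⁻¹' N) = 0) :
    ∀ᵐ ω ∂μ, ∀ x ∈ Φ ω ∩ A, ∀ y ∈ Φ ω ∩ B, (x, y) ∉ N := by
  set κ := pointKernel h.counts with hκ
  set ν := μ.bind κ with hν
  have hνσ : SigmaFinite ν := h.sigmaFinite_bind_pointKernel hΛ
  -- Counts in disjoint sets are independent, so the mean measure of pairs in `A × B` is the product
  -- of the mean measures.
  have hprod : (ν.restrict A).prod (ν.restrict B) =
      μ.bind (κ.restrict hA ×ₖ κ.restrict hB) := by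
    refine Measure.prod_eq fun s t hs ht => ?_
    have hind : IndepFun (fun ω => κ ω (s ∩ A)) (fun ω => κ ω (t ∩ B)) μ := by
      have := h.indep_counts 2 ![s ∩ A, t ∩ B]
        (by intro k; fin_cases k; exacts [hs.inter hA, ht.inter hB]) (by
          have hd : Disjoint (s ∩ A) (t ∩ B) :=
            hAB.mono Set.inter_subset_right Set.inter_subset_right
          intro k l hkl
          fin_cases k <;> fin_cases l
          exacts [absurd rfl hkl, hd, hd.symm, absurd rfl hkl])
      have h01 := this.indepFun (i := 0) (j := 1) (by decide)
      have := h01.comp (φ := fun n : ℕ∞ => (n : ℝ≥0∞)) (ψ := fun n : ℕ∞ => (n : ℝ≥0∞))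
        .of_discrete .of_discrete
      convert this using 1 <;> funext ω
      · exact pointKernel_apply' _ _ (hs.inter hA)
      · exact pointKernel_apply' _ _ (ht.inter hB)
    rw [Measure.bind_apply (hs.prod ht) (Kernel.aemeasurable _), Measure.restrict_apply hs,
      Measure.restrict_apply ht, hν, Measure.bind_apply (hs.inter hA) (Kernel.aemeasurable _),
      Measure.bind_apply (ht.inter hB) (Kernel.aemeasurable _)]
    rw [← lintegral_mul_eq_lintegral_mul_lintegral_of_indepFun
      (Kernel.measurable_coe _ (hs.inter hA)) (Kernel.measurable_coe _ (ht.inter hB)) hind]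
    refine lintegral_congr fun ω => ?_
    rw [Kernel.prod_apply, Measure.prod_prod, Kernel.restrict_apply, Kernel.restrict_apply,
      Measure.restrict_apply hs, Measure.restrict_apply ht]
    rfl
  -- Sections of `N` are `Λ`-null, hence contain no points almost surely, hence have zero mean
  -- count.
  have hnull : μ.bind (κ.restrict hA ×ₖ κ.restrict hB) N = 0 := by
    rw [← hprod, Measure.measure_prod_null hN]
    refine Filter.Eventually.of_forall fun x => ?_
    exact nonpos_iff_eq_zero.1 ((Measure.restrict_apply_le _ _).trans
      (h.bind_pointKernel_eq_zero (measurable_prodMk_left hN) (hN0 x)).le)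
  rw [Measure.bind_apply hN (Kernel.aemeasurable _),
    lintegral_eq_zero_iff (Kernel.measurable_coe _ hN)] at hnull
  filter_upwards [hnull] with ω hω x hx y hy hxy
  -- A pair of points lying in `N` would carry mass one, although `N` has mass zero.
  have hle : (κ.restrict hA ×ₖ κ.restrict hB) ω ({x} ×ˢ {y}) ≤ 0 := by
    refine (measure_mono ?_).trans hω.le
    rintro ⟨a, b⟩ ⟨rfl, rfl⟩
    exact hxy
  rw [Kernel.prod_apply, Measure.prod_prod, Kernel.restrict_apply, Kernel.restrict_apply,
    Measure.restrict_apply (measurableSet_singleton x),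
    Measure.restrict_apply (measurableSet_singleton y),
    Set.inter_eq_left.2 (Set.singleton_subset_iff.2 hx.2),
    Set.inter_eq_left.2 (Set.singleton_subset_iff.2 hy.2), hκ,
    pointKernel_apply' _ _ (measurableSet_singleton x),
    pointKernel_apply' _ _ (measurableSet_singleton y),
    Set.inter_eq_right.2 (Set.singleton_subset_iff.2 hx.1),
    Set.inter_eq_right.2 (Set.singleton_subset_iff.2 hy.1)] at hle
  simp at hle

/-- The pairs of distinct points of a Poisson process avoid a null set of pairs. -/
theorem IsPoissonProcess.ae_notMem_of_ne [IsProbabilityMeasure μ]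
    (h : IsPoissonProcess Φ Λ μ) (hΛ : ∀ B, Bornology.IsBounded B → Λ B ≠ ∞)
    {N : Set (S × S)} (hN : MeasurableSet N) (hN0 : ∀ x, Λ (Prod.mk x ⁻¹' N) = 0) :
    ∀ᵐ ω ∂μ, ∀ x ∈ Φ ω, ∀ y ∈ Φ ω, x ≠ y → (x, y) ∉ N := by
  -- Any two distinct points are separated by some `D` and its complement, and countably many `D`
  -- suffice.
  have : ∀ᵐ ω ∂μ, ∀ D ∈ TopologicalSpace.countableBasis S,
      ∀ x ∈ Φ ω ∩ D, ∀ y ∈ Φ ω ∩ Dᶜ, (x, y) ∉ N := by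
    rw [ae_ball_iff (TopologicalSpace.countable_countableBasis S)]
    intro D hD
    have hDm := (TopologicalSpace.isOpen_of_mem_countableBasis hD).measurableSet
    exact h.ae_notMem_of_disjoint hΛ hDm hDm.compl disjoint_compl_right hN hN0
  filter_upwards [this] with ω hω x hx y hy hxy
  obtain ⟨D, hD, hxD, hDs⟩ := (TopologicalSpace.isBasis_countableBasis S).exists_subset_of_mem_open
    (a := x) (u := {y}ᶜ) hxy isOpen_compl_singleton
  exact hω D hD x ⟨hx, hxD⟩ y ⟨hy, fun hyD => hDs hyD rfl⟩

end PointProcess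

/-! ### Association cells -/

instance : Countable Tier :=
  ⟨⟨fun i => Tier.casesOn i 0 1, fun i j h => by cases i <;> cases j <;> simp_all⟩⟩

instance : Countable LinkState :=
  ⟨⟨fun s => LinkState.casesOn s 0 1, fun s t h => by cases s <;> cases t <;> simp_all⟩⟩

/-- The power received at `z` from a base station of tier `i` at `x`, with weight `K i`. -/
def signal (p : Params) (K : Tier → ℝ≥0∞) (k : LinkType) (c : Config) (i : Tier)
    (x z : Plane) : ℝ≥0∞ :=
  K i * (pathloss p c k i x z)⁻¹

/-- The locations which receive no larger power from the base stations of the tiers in `J` than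
from a base station of tier `i` at `x`. -/
def cell (p : Params) (K : Tier → ℝ≥0∞) (k : LinkType) (J : Set Tier) (c : Config) (i : Tier)
    (x : Plane) : Set Plane :=
  {z | ∀ j ∈ J, ∀ y ∈ c.bs j, signal p K k c j y z ≤ signal p K k c i x z}

/-! #### Translation covariance -/

theorem blockageSegment_translate (len : ℝ) (q : Plane × ℝ) (t : Plane) :
    blockageSegment len (q.1 + t, q.2) = (fun y => t + y) '' blockageSegment len q := by
  rw [blockageSegment, blockageSegment, segment_translate_image]
  congr 1 <;> dsimp only <;> abel

theorem linkState_seenFrom (p : Params) (c : Config) (t x z : Plane) :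
    linkState p (c.seenFrom t) x z = linkState p c (x + t) (z + t) := by
  have h : (∀ q ∈ (c.seenFrom t).bl, Disjoint (blockageSegment p.Lbl q) (segment ℝ x z)) ↔
      ∀ q ∈ c.bl, Disjoint (blockageSegment p.Lbl q) (segment ℝ (x + t) (z + t)) := by
    refine Iff.trans (forall_congr' fun q => ?_) ((translateMarked t).surjective.forall
      (p := fun q => q ∈ c.bl →
        Disjoint (blockageSegment p.Lbl q) (segment ℝ (x + t) (z + t)))).symm
    rw [translateMarked_apply, blockageSegment_translate, add_comm x t, add_comm z t,
      ← segment_translate_image, Set.disjoint_image_iff (add_right_injective t)]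
    rfl
  classical
  exact if_congr h rfl rfl

theorem signal_seenFrom (p : Params) (K : Tier → ℝ≥0∞) (k : LinkType) (c : Config) (i : Tier)
    (t x z : Plane) :
    signal p K k (c.seenFrom t) i x z = signal p K k c i (x + t) (z + t) := by
  rw [signal, signal, pathloss, pathloss, linkState_seenFrom, add_sub_add_right_eq_sub]

theorem mem_cell_seenFrom (p : Params) (K : Tier → ℝ≥0∞) (k : LinkType) (J : Set Tier)
    (c : Config) (i : Tier) (t x z : Plane) :
    z ∈ cell p K k J (c.seenFrom t) i x ↔ z + t ∈ cell p K k J c i (x + t) := by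
  simp only [cell, Set.mem_ofPred_eq, signal_seenFrom]
  refine forall₂_congr fun j _ => ?_
  exact ((Equiv.addRight t).surjective.forall (p := fun y => y ∈ c.bs j →
    signal p K k c j y (z + t) ≤ signal p K k c i (x + t) (z + t))).symm

/-! #### Measurability -/

/-- Two segments meet when some pair of parameters in the unit square gives the same point. This is
a closed condition, and projecting along the compact square keeps it closed. -/
theorem isClosed_setOf_not_disjoint_segment (len : ℝ) :
    IsClosed {r : (Plane × Plane) × (Plane × ℝ) |
      ¬ Disjoint (blockageSegment len r.2) (segment ℝ r.1.1 r.1.2)} := by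
  let D : Plane × ℝ → Plane := fun q => (len / 2) • !₂[Real.cos q.2, Real.sin q.2]
  have hD : Continuous D := by
    refine Continuous.const_smul (c := len / 2) ?_
    have : Continuous fun q : Plane × ℝ => ![Real.cos q.2, Real.sin q.2] := by
      refine continuous_pi fun k => ?_
      fin_cases k
      · exact Real.continuous_cos.comp continuous_snd
      · exact Real.continuous_sin.comp continuous_snd
    exact (PiLp.continuous_toLp 2 fun _ : Fin 2 => ℝ).comp this
  let Z : Set ((unitInterval × unitInterval) × ((Plane × Plane) × (Plane × ℝ))) :=
    {w | AffineMap.lineMap (w.2.2.1 - D w.2.2) (w.2.2.1 + D w.2.2) (w.1.1 : ℝ) =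
      AffineMap.lineMap (k := ℝ) w.2.1.1 w.2.1.2 (w.1.2 : ℝ)}
  have hZ : IsClosed Z := by
    simp only [Z, AffineMap.lineMap_apply_module]
    exact isClosed_eq (by fun_prop) (by fun_prop)
  convert isClosedMap_snd_of_compactSpace Z hZ using 1
  ext r
  simp only [Set.mem_ofPred_eq, Set.not_disjoint_iff, blockageSegment, segment_eq_image_lineMap,
    Set.mem_image, Z]
  constructor
  · rintro ⟨_, ⟨s, hs, rfl⟩, ⟨t, ht, hst⟩⟩
    exact ⟨⟨(⟨s, hs⟩, ⟨t, ht⟩), r⟩, hst.symm, rfl⟩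
  · rintro ⟨⟨⟨s, t⟩, r'⟩, hst, rfl⟩
    exact ⟨_, ⟨s, s.2, rfl⟩, ⟨t, t.2, hst.symm⟩⟩

section Measurability

variable {Y : Type*} [MeasurableSpace Y]

theorem measurableSet_linkState (p : Params) {c : Y → LFConfig} {x z : Y → Plane}
    (hc : Measurable c) (hx : Measurable x) (hz : Measurable z) :
    MeasurableSet {y | linkState p (c y).1 (x y) (z y) = .los} := by
  have h := measurableSet_exists_mem_point isPointProcess_bl hc
    (R := (fun r : Y × (Plane × ℝ) => ((x r.1, z r.1), r.2)) ⁻¹' _)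
    ((isClosed_setOf_not_disjoint_segment p.Lbl).measurableSet.preimage (by fun_prop))
  convert h.compl using 1
  ext y
  simp [linkState]

theorem measurable_signal (p : Params) (K : Tier → ℝ≥0∞) (k : LinkType) (i : Tier)
    {c : Y → LFConfig} {x z : Y → Plane} (hc : Measurable c) (hx : Measurable x)
    (hz : Measurable z) : Measurable fun y => signal p K k (c y).1 i (x y) (z y) := by
  classical
  have hpow : Measurable fun y => ‖x y - z y‖ ^ p.α k i (linkState p (c y).1 (x y) (z y)) := by
    have : (fun y => p.α k i (linkState p (c y).1 (x y) (z y))) = fun y =>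
        if y ∈ {y | linkState p (c y).1 (x y) (z y) = .los} then p.α k i .los
        else p.α k i .nlos := by
      funext y
      split_ifs with hy
      · rw [show linkState p (c y).1 (x y) (z y) = .los from hy]
      · generalize hs : linkState p (c y).1 (x y) (z y) = s
        cases s
        exacts [absurd hs hy, rfl]
    refine Measurable.pow (by fun_prop) ?_
    rw [this]
    exact Measurable.ite (measurableSet_linkState p hc hx hz) measurable_const measurable_const
  exact (hpow.ennreal_ofReal.inv).const_mul _

theorem measurableSet_mem_cell (p : Params) (K : Tier → ℝ≥0∞) (k : LinkType) (J : Set Tier)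
    (i : Tier) : MeasurableSet
      {r : (LFConfig × Plane) × Plane | r.1.2 ∈ cell p K k J r.1.1.1 i r.2} := by
  -- A location is outside the cell exactly when some station delivers strictly more power, an
  -- existential over points.
  have : {r : (LFConfig × Plane) × Plane | r.1.2 ∈ cell p K k J r.1.1.1 i r.2} =
      ⋂ j ∈ J, {r | ∃ y ∈ r.1.1.1.bs j,
        (r, y) ∈ {w : ((LFConfig × Plane) × Plane) × Plane |
          signal p K k w.1.1.1.1 i w.1.2 w.1.1.2 < signal p K k w.1.1.1.1 j w.2 w.1.1.2}}ᶜ := by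
    ext r
    simp [cell]
  rw [this]
  refine MeasurableSet.biInter (Set.to_countable J) fun j _ => MeasurableSet.compl ?_
  exact measurableSet_exists_mem_point (isPointProcess_bs j)
    (g := fun r : (LFConfig × Plane) × Plane => r.1.1) (by fun_prop) (measurableSet_lt
      (measurable_signal p K k i (by fun_prop) (by fun_prop) (by fun_prop))
      (measurable_signal p K k j (by fun_prop) (by fun_prop) (by fun_prop)))

end Measurability

/-! #### Uniqueness of the serving base station -/

/-- As `b` is positive, the equation determines `‖y‖`, so `y` lies on a circle about the origin. -/
theorem volume_setOf_rpow_norm_eq (x : Plane) (a : ℝ) {b : ℝ} (hb : 0 < b) :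
    volume {y : Plane | ‖x‖ ^ a = ‖y‖ ^ b} = 0 := by
  refine measure_mono_null (fun y hy => ?_)
    (Measure.addHaar_sphere volume (0 : Plane) ((‖x‖ ^ a) ^ b⁻¹))
  rw [mem_sphere_zero_iff_norm, show ‖x‖ ^ a = ‖y‖ ^ b from hy,
    Real.rpow_rpow_inv (norm_nonneg y) hb.ne']

section Network

variable {Ω : Type*} [MeasurableSpace Ω] {μ : Measure Ω} [IsProbabilityMeasure μ]
  {net : Ω → Config} {lam : Tier → ℝ} {lamBl : ℝ}

/-- Since `i ∈ J`, two serving stations deliver equal power, and their common weight cancels. The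
link states depend on the blockages, so ties are excluded for every fixed pair of states at once. -/
theorem IsNetwork.ae_unique_serving (h : IsNetwork μ net lam lamBl) (p : Params)
    {K : Tier → ℝ≥0∞} (hK0 : ∀ i, K i ≠ 0) (hK : ∀ i, K i ≠ ∞) (k : LinkType) {J : Set Tier}
    {i : Tier} (hi : i ∈ J) :
    ∀ᵐ ω ∂μ, ∀ x ∈ (net ω).bs i, ∀ y ∈ (net ω).bs i,
      0 ∈ cell p K k J (net ω) i x → 0 ∈ cell p K k J (net ω) i y → x = y := by
  have hΛ : ∀ B : Set Plane, Bornology.IsBounded B →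
      (ENNReal.ofReal (lam i) • (volume : Measure Plane)) B ≠ ∞ := fun B hB =>
    ENNReal.mul_ne_top ENNReal.ofReal_ne_top hB.measure_lt_top.ne
  have hpair : ∀ᵐ ω ∂μ, ∀ s t : LinkState, ∀ x ∈ (net ω).bs i, ∀ y ∈ (net ω).bs i, x ≠ y →
      (x, y) ∉ {r : Plane × Plane | ‖r.1‖ ^ p.α k i s = ‖r.2‖ ^ p.α k i t} := by
    rw [ae_all_iff]
    intro s
    rw [ae_all_iff]
    intro t
    refine (h.poisson_bs i).ae_notMem_of_ne hΛ
      (measurableSet_eq_fun (by fun_prop) (by fun_prop)) fun x => ?_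
    rw [Measure.smul_apply]
    simp [volume_setOf_rpow_norm_eq x (p.α k i s) (p.α_pos k i t)]
  filter_upwards [hpair] with ω hω x hx y hy hxc hyc
  by_contra hxy
  refine hω (linkState p (net ω) x 0) (linkState p (net ω) y 0) x hx y hy hxy ?_
  have heq := le_antisymm (hyc i hi x hx) (hxc i hi y hy)
  rw [signal, signal, ENNReal.mul_right_inj (hK0 i) (hK i), inv_inj, pathloss, pathloss,
    ENNReal.ofReal_eq_ofReal_iff (by positivity) (by positivity), sub_zero, sub_zero] at heq
  exact heq

/-! ### The mean area of a typical cell -/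

/-- Common form of both claims: access takes all tiers in `J`, backhaul takes unit weights and the
macro tier alone. -/
theorem IsNetwork.palmMean_volume_cell (h : IsNetwork μ net lam lamBl) (p : Params)
    {K : Tier → ℝ≥0∞} (hK0 : ∀ i, K i ≠ 0) (hK : ∀ i, K i ≠ ∞) (k : LinkType) {J : Set Tier}
    {i : Tier} (hi : i ∈ J) (hlam : 0 < lam i) {W : Set Plane} (hW : MeasurableSet W)
    (hW0 : volume W ≠ 0) (hW1 : volume W ≠ ∞) :
    palmMean μ net i (lam i) W (fun c => volume (cell p K k J c i 0)) =
      μ {ω | ∃ x ∈ (net ω).bs i, 0 ∈ cell p K k J (net ω) i x} / ENNReal.ofReal (lam i) := by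
  set R := {r : (LFConfig × Plane) × Plane | r.1.2 ∈ cell p K k J r.1.1.1 i r.2} with hRdef
  have hR : MeasurableSet R := measurableSet_mem_cell p K k J i
  have hm := h.measurable_toLFConfig
  have hsum : ∀ ω, ∑' x : ↥((net ω).bs i ∩ W), volume (cell p K k J ((net ω).seenFrom x) i 0) =
      ∫⁻ x in W, volume {z | ((h.toLFConfig ω, z), x) ∈ R} ∂bsKernel i (h.toLFConfig ω) := by
    intro ω
    rw [bsKernel, setLIntegral_pointKernel _ _ _ hW]
    refine tsum_congr fun x => ?_
    -- The cell seen from `x` is a translate of the cell of `x`, so it has the same area.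
    have : cell p K k J ((net ω).seenFrom x) i 0 =
        (fun z => z + (x : Plane)) ⁻¹' cell p K k J (net ω) i x := by
      ext z
      rw [mem_cell_seenFrom, zero_add]
      rfl
    rw [this, measure_preimage_add_right]
    rfl
  have hvol : Measurable fun c : LFConfig =>
      ∫⁻ x in W, volume {z | ((c, z), x) ∈ R} ∂bsKernel i c := by
    have hg : Measurable fun r : (LFConfig × Plane) × Plane => ((r.1.1, r.2), r.1.2) := by
      fun_prop
    have : Measurable fun r : LFConfig × Plane => volume {z | ((r.1, z), r.2) ∈ R} :=
      measurable_measure_prodMk_left (hR.preimage hg)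
    exact Measurable.setLIntegral_kernel_prod_right (κ := bsKernel i)
      (f := fun c x => volume {z | ((c, z), x) ∈ R}) this hW
  have hex : MeasurableSet {c : LFConfig | ∃ x ∈ c.1.bs i, ((c, 0), x) ∈ R} :=
    measurableSet_exists_related i hR measurable_const
  have huniq : ∀ᵐ c ∂h.law, ∀ x ∈ c.1.bs i, ∀ y ∈ c.1.bs i,
      ((c, 0), x) ∈ R → ((c, 0), y) ∈ R → x = y := by
    have hae : ∀ᵐ c ∂h.law, c ∉ {c : LFConfig | ∃ x ∈ c.1.bs i, ((c, 0), x) ∈ R ∧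
        ∃ y ∈ c.1.bs i, ((c, 0), y) ∈ R ∧ x ≠ y} := by
      rw [IsNetwork.law, ae_map_iff hm.aemeasurable
        (measurableSet_exists_ne_related i hR measurable_const).compl]
      filter_upwards [h.ae_unique_serving p hK0 hK k hi] with ω hω
      rintro ⟨x, hx, hxR, y, hy, hyR, hxy⟩
      exact hxy (hω x hx y hy hxR hyR)
    filter_upwards [hae] with c hc x hx y hy hxR hyR
    by_contra hxy
    exact hc ⟨x, hx, hxR, y, hy, hyR, hxy⟩
  have hmain := lintegral_volume_cells h.measurePreserving_shift i hR
    (fun c x z t => mem_cell_seenFrom p K k J c.1 i t x z) huniq hW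
  rw [IsNetwork.law, lintegral_map hvol hm, Measure.map_apply hm hex] at hmain
  rw [palmMean]
  simp_rw [hsum]
  rw [hmain, ENNReal.mul_inv (Or.inl (ENNReal.ofReal_pos.2 hlam).ne')
    (Or.inl ENNReal.ofReal_ne_top), mul_assoc, ← mul_assoc (volume W)⁻¹,
    ENNReal.inv_mul_cancel hW0 hW1, one_mul, mul_comm, ← div_eq_mul_inv]
  rfl

/-! ### Access and backhaul cells -/

theorem accessCell_eq_cell (p : Params) (c : Config) (i : Tier) (x : Plane) :
    accessCell p c i x =
      cell p (fun j => ENNReal.ofReal (p.P j * p.T j * p.β j * p.G j)) .access Set.univ c i x := by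
  ext z
  simp [accessCell, cell, signal]

theorem backhaulCell_eq_cell (p : Params) (c : Config) (x : Plane) :
    backhaulCell p c x = cell p 1 .backhaul {.m} c .m x := by
  ext z
  simp [backhaulCell, cell, signal]

/-- The user gain is a positive finite factor common to all stations and cancels. -/
theorem servesOrigin_iff (p : Params) (c : Config) (i : Tier) (x : Plane) :
    ServesOrigin p c i x ↔ x ∈ c.bs i ∧ 0 ∈ accessCell p c i x := by
  have hG : ∀ j y, biasedPower p c j y 0 = ENNReal.ofReal p.Gu *
      (ENNReal.ofReal (p.P j * p.T j * p.β j * p.G j) * (pathloss p c .access j y 0)⁻¹) := by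
    intro j y
    rw [biasedPower, mul_comm _ p.Gu, ENNReal.ofReal_mul p.Gu_pos.le, mul_assoc]
  simp only [ServesOrigin, accessCell, Set.mem_ofPred_eq, hG]
  refine and_congr_right fun _ => forall₃_congr fun j y _ => ?_
  exact ENNReal.mul_le_mul_iff_right (ENNReal.ofReal_pos.2 p.Gu_pos).ne' ENNReal.ofReal_ne_top

/-- Almost surely, there is a base station. -/
theorem IsNetwork.ae_bs_nonempty {Ω : Type*} [MeasurableSpace Ω] {μ : Measure Ω}
    {net : Ω → Config} {lam : Tier → ℝ} {lamBl : ℝ} (h : IsNetwork μ net lam lamBl) {i : Tier}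
    (hlam : 0 < lam i) :
    ∀ᵐ ω ∂μ, ((net ω).bs i).Nonempty := by
  have hv : ∀ n : ℕ, (ENNReal.ofReal (lam i) • (volume : Measure Plane)) (Metric.ball 0 n) =
      ENNReal.ofReal (lam i * Real.pi * n ^ 2) := by
    intro n
    rw [Measure.smul_apply, EuclideanSpace.volume_ball_fin_two, smul_eq_mul, mul_assoc,
      ENNReal.ofReal_mul hlam.le, ENNReal.ofReal_mul Real.pi_nonneg,
      ENNReal.ofReal_pow (by positivity), mul_comm (ENNReal.ofReal Real.pi)]
  -- Without stations every disc of radius `n` is void, and these void probabilities tend to zero.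
  have hle : ∀ n : ℕ, μ {ω | ¬ ((net ω).bs i).Nonempty} ≤
      ENNReal.ofReal (Real.exp (-(lam i * Real.pi * n ^ 2))) := by
    intro n
    refine (measure_mono fun ω hω => ?_).trans
      (((h.poisson_bs i).measure_void measurableSet_ball (hv n ▸ ENNReal.ofReal_ne_top)).trans
        ?_).le
    · rw [Set.mem_ofPred_eq, Set.not_nonempty_iff_eq_empty.1 hω, Set.empty_inter]
    · rw [hv, poissonMeasure_singleton, ENNReal.coe_toNNReal_eq_toReal,
        ENNReal.toReal_ofReal (by positivity)]
      simp
  have htend : Filter.Tendsto (fun n : ℕ => ENNReal.ofReal (Real.exp (-(lam i * Real.pi * n ^ 2))))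
      Filter.atTop (nhds 0) := by
    rw [← ENNReal.ofReal_zero]
    refine ENNReal.tendsto_ofReal (Real.tendsto_exp_neg_atTop_nhds_zero.comp ?_)
    exact ((Filter.tendsto_pow_atTop two_ne_zero).comp
      tendsto_natCast_atTop_atTop).const_mul_atTop (by positivity)
  exact nonpos_iff_eq_zero.1 (ge_of_tendsto' htend hle)

/-- Stations with pathloss at most that of a given one lie in a bounded disc, so there are finitely
many and one minimizes. -/
theorem Config.LocallyFinite.exists_mem_backhaulCell {c : Config} (hc : c.LocallyFinite)
    (p : Params) (hne : (c.bs .m).Nonempty) : ∃ x ∈ c.bs .m, 0 ∈ backhaulCell p c x := by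
  obtain ⟨x₀, hx₀⟩ := hne
  set f : Plane → ℝ := fun x => ‖x‖ ^ p.α .backhaul .m (linkState p c x 0) with hf
  -- Beyond the radius `r s`, a link in state `s` is worse than that of `x₀`; the larger of the two
  -- radii serves for both states.
  set r : LinkState → ℝ := fun s => f x₀ ^ (p.α .backhaul .m s)⁻¹
  have hfin : (c.bs .m ∩ {x | f x ≤ f x₀}).Finite := by
    refine (hc.bs_finite .m (Metric.closedBall 0 (max (r .los) (r .nlos)))
      Metric.isBounded_closedBall).subset (Set.inter_subset_inter_right _ fun x hx => ?_)
    have hr : ‖x‖ ≤ r (linkState p c x 0) := by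
      have hα := p.α_pos .backhaul .m (linkState p c x 0)
      rw [← Real.rpow_rpow_inv (norm_nonneg x) hα.ne']
      exact Real.rpow_le_rpow (by positivity) hx (inv_nonneg.2 hα.le)
    rw [mem_closedBall_zero_iff]
    generalize linkState p c x 0 = s at hr
    cases s
    exacts [hr.trans (le_max_left _ _), hr.trans (le_max_right _ _)]
  obtain ⟨x, hx, hmin⟩ := Set.exists_min_image _ f hfin ⟨x₀, hx₀, le_refl (f x₀)⟩
  refine ⟨x, hx.1, fun y hy => ?_⟩
  rw [ENNReal.inv_le_inv, pathloss, pathloss, sub_zero, sub_zero]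
  refine ENNReal.ofReal_le_ofReal ?_
  rcases le_total (f y) (f x₀) with hle | hle
  · exact hmin y ⟨hy, hle⟩
  · exact (hmin x₀ ⟨hx₀, le_refl (f x₀)⟩).trans hle

end Network

end

end IAB

/-! ### The two mean cell areas -/

theorem mainTheorem8 {Ω : Type*} [MeasurableSpace Ω] (μ : MeasureTheory.Measure Ω)
    [MeasureTheory.IsProbabilityMeasure μ] (p : IAB.Params) (lam : IAB.Tier → ℝ)
    (hlam : ∀ i, 0 < lam i) (lamBl : ℝ) (hlamBl : 0 ≤ lamBl) (net : Ω → IAB.Config)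
    (hnet : IAB.IsNetwork μ net lam lamBl)
    (W : Set IAB.Plane) (hW : MeasurableSet W) (hW0 : MeasureTheory.volume W ≠ 0)
    (hW1 : MeasureTheory.volume W ≠ ⊤) :
    IAB.palmMean μ net .m (lam .m) W
        (fun c => MeasureTheory.volume (IAB.backhaulCell p c 0)) = 1 / ENNReal.ofReal (lam .m) ∧
      ∀ i : IAB.Tier,
        IAB.palmMean μ net i (lam i) W
            (fun c => MeasureTheory.volume (IAB.accessCell p c i 0)) =
          IAB.assocProb μ p net i / ENNReal.ofReal (lam i) := by
  constructor
  · simp_rw [IAB.backhaulCell_eq_cell]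
    rw [hnet.palmMean_volume_cell p (K := 1) (fun _ => one_ne_zero) (fun _ => ENNReal.one_ne_top) _
      (Set.mem_singleton _) (hlam .m) hW hW0 hW1]
    congr 1
    -- The numerator is one: whenever a macro station exists, some macro station's backhaul cell
    -- contains the origin.
    rw [← measure_univ (μ := μ)]
    refine measure_congr (Filter.eventuallyEq_univ.2 ?_)
    filter_upwards [hnet.ae_bs_nonempty (hlam .m)] with ω hω
    simpa only [IAB.backhaulCell_eq_cell] using
      (hnet.locallyFinite ω).exists_mem_backhaulCell p hω
  · intro i
    have hpos : ∀ j, 0 < p.P j * p.T j * p.β j * p.G j := fun j =>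
      mul_pos (mul_pos (mul_pos (p.P_pos j) (p.T_pos j)) (p.β_pos j)) (p.G_pos j)
    simp_rw [IAB.accessCell_eq_cell]
    rw [hnet.palmMean_volume_cell p (fun j => (ENNReal.ofReal_pos.2 (hpos j)).ne')
      (fun _ => ENNReal.ofReal_ne_top) _ (Set.mem_univ i) (hlam i) hW hW0 hW1]
    simp_rw [IAB.assocProb, IAB.servesOrigin_iff, IAB.accessCell_eq_cell]
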